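/- \textbf{Setting.} Processes are taken in the stable-failures model of CSP over a set $\Sigma$ of events ($\checkmark\notin\Sigma$ signals termination): a process $P$ is given by its traces and its stable failures $(s,X)$, subject to the usual healthiness conditions. $Q \sqsubseteq_F P$ means $\mathrm{traces}(P)\subseteq \mathrm{traces}(Q)$ and $\mathrm{failures}(P)\subseteq\mathrm{failures}(Q)$; recursion $X=F(X)$ denotes $\bigsqcap_{m} F^m(\mathrm{div})$. A network $V=\langle (A_1,P_1),\dots,(A_n,P_n)\rangle$, $n\ge 1$, consists of alphabets $A_i\subseteq\Sigma$ and processes $P_i$ all of whose events lie in $A_i$. It is \emph{live} if every $P_i$ is deadlock free (never stably refuses $\Sigma\cup\{\checkmark\}$ after a trace in $\Sigma^*$), no $P_i$ terminates, and every event belongs to at most two of the $A_i$. Let $\mathit{Voc}=\bigcup_{i\ne j}(A_i\cap A_j)$ and $\mathrm{Abs}(i)=P_i\setminus(\Sigma-\mathit{Voc})$ (hiding). A state of $V$ is a pair $(s,(R_1,\dots,R_n))$ with $s\in\Sigma^*$ and $(s\restriction A_i,R_i)\in\mathrm{failures}(P_i)$ for all $i$; it is deadlocked if $\bigcup_i (A_i\cap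 R_i)=\bigcup_i A_i$; $V$ is \emph{deadlock free} if it has no deadlocked state. \textbf{Descriptor.} Let $\mathcal C\subseteq\{1,\dots,n\}^2$ and, for $(i,j)\in\mathcal C$, let $link(i,j)\in\{1,\dots,n\}$ be a component, with $link$ injective on $\mathcal C$; let $D_{ij}$ be a nonempty set of data, let $send_{ij}.d$ and $receive_{ij}.d$ ($d\in D_{ij}$) be events, forming the sets $send(i,j)$ and $receive(i,j)$, and let $on(i,j)$, $off(i,j)$, $timeout(i,j)$ be events. The participants are the indices occurring in a pair of $\mathcal C$; the transport entities are the $link(i,j)$, $(i,j)\in\mathcal C$. For each participant $i$ let $S(i)$ be a finite sequence of components. \textbf{Structural compliance.} (a) Participants and transport entities partition $\{1,\dots,n\}$. (b) The five sets of all send, receive, on, off and timeout events (over $\mathcal C$) are pairwise disjoint. (c) For each participant $i$, $$A_i\cap \mathit{Voc}=\bigcup_{(i,j)\in\mathcal C}\bigl(send(i,j)\cup\{on(i,j),off(i,j)\}\bigr)\cup\bigcup_{(j,i)\in\mathcal C}\bigl(receive(j,i)\cup\{timeout(j,i)\}\bigr).$$ (d) For each $(i,j)\in\mathcal C$, $A_{link(i,j)}\cap\mathit{Voc}=send(i,j)\cup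 receive(i,j)\cup\{on(i,j),off(i,j),timeout(i,j)\}$. \textbf{Behavioural compliance.} (e) For each $(i,j)\in\mathcal C$, $\mathit{TransportSpec}\sqsubseteq_F\mathrm{Abs}(link(i,j))$, where $\mathit{TransportSpec}=\mathit{Off}$ is given by ($\Box$ is external choice) $$\mathit{Off}=on(i,j)\to \mathit{On}\ \Box\ timeout(i,j)\to \mathit{Off},\qquad \mathit{On}=off(i,j)\to \mathit{Off}\ \Box\ send_{ij}?d\to \mathit{OnF}(d),$$ $$\mathit{OnF}(d)=off(i,j)\to \mathit{Off}\ \Box\ send_{ij}?d'\to \mathit{OnF}(d')\ \Box\ receive_{ij}.d\to \mathit{On}.$$ (f) For each participant $i$, $\mathit{ParticipantSpec}(i)\sqsubseteq_F\mathrm{Abs}(i)$, where $$\mathit{ParticipantSpec}(i)=\mathit{OnDetect};\bigl(\mathit{SendReceive}\,\triangle\,(\mathit{SKIP}\sqcap \mathit{STOP})\bigr);\mathit{OffDetect};\mathit{ParticipantSpec}(i),$$ $\mathit{SendReceive}=\mathit{Send};\mathit{Receive};\mathit{SendReceive}$, and $\triangle$ is interrupt. Here $\mathit{OnDetect}$ (resp.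 $\mathit{OffDetect}$) performs $on(i,j)$ (resp. $off(i,j)$), and $\mathit{Send}$ performs $send_{ij}.d$ for some internally chosen $d$, once for each entry $j$ of $S(i)$ with $(i,j)\in\mathcal C$, in the order of $S(i)$, and then terminates; $\mathit{Receive}$ offers the external choice of all $receive_{ji}.d$ and $timeout(j,i)$ for each entry $j$ of $S(i)$ with $(j,i)\in\mathcal C$, in the order of $S(i)$, and then terminates. (g) For each participant $i$, no component occurs twice in $S(i)$. \textbf{Theorem (async dynamic).} Every live network $V$ that is structurally and behaviourally compliant, in the above sense, with such a descriptor and such sequences $S(i)$ is deadlock free. -/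

import Mathlib

universe u v

namespace CSP

/-- Observable events together with the termination signal: `some a` is the event `a`,
`none` is the termination signal (tick). -/
abbrev Obs (E : Type u) : Type u := Option E

/-- A point of the stable-failures semantics: a set of finite traces and a set of stable failures
(trace, refusal set). -/
@[ext] structure Sem (E : Type u) where
  traces : Set (List (Obs E))
  failures : Set (List (Obs E) × Set (Obs E))

namespace Sem

variable {E : Type u}

/-- The healthiness conditions of the stable-failures model. -/
structure Healthy (P : Sem E) : Prop where
  nil_mem : [] ∈ P.traces
  prefix_closed : ∀ s t, s ++ t ∈ P.traces → s ∈ P.traces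
  tick_last : ∀ s t, s ++ none :: t ∈ P.traces → t = []
  trace_of_failure : ∀ s X, (s, X) ∈ P.failures → s ∈ P.traces
  subset_closed : ∀ s X Y, (s, X) ∈ P.failures → Y ⊆ X → (s, Y) ∈ P.failures
  refuse_impossible : ∀ s X Y, (s, X) ∈ P.failures →
    (∀ a ∈ Y, s ++ [a] ∉ P.traces) → (s, X ∪ Y) ∈ P.failures
  before_tick : ∀ s, s ++ [none] ∈ P.traces → (s, {x | x ≠ none}) ∈ P.failures
  after_tick : ∀ s X, s ++ [none] ∈ P.traces → (s ++ [none], X) ∈ P.failures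

/-- `Spec [F= Impl`. -/
def Refines (Spec Impl : Sem E) : Prop :=
  Impl.traces ⊆ Spec.traces ∧ Impl.failures ⊆ Spec.failures

/-- No reachable stable refusal of everything (successful termination is not deadlock). -/
def DeadlockFree (P : Sem E) : Prop :=
  ∀ s : List E, (s.map some, Set.univ) ∉ P.failures

def NonTerminating (P : Sem E) : Prop :=
  ∀ s, s ++ [none] ∉ P.traces

/-! ### Operators -/

def STOP : Sem E where
  traces := {[]}
  failures := {f | f.1 = []}

def SKIP : Sem E where
  traces := {[], [none]}
  failures := {f | f.1 = [] ∧ none ∉ f.2} ∪ {f | f.1 = [none]}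

/-- The diverging process. -/
def DIV : Sem E where
  traces := {[]}
  failures := ∅

/-- `a -> P`. -/
def pre (a : E) (P : Sem E) : Sem E where
  traces := {[]} ∪ {t | ∃ s ∈ P.traces, t = some a :: s}
  failures := {f | f.1 = [] ∧ some a ∉ f.2} ∪
    {f | ∃ s, (s, f.2) ∈ P.failures ∧ f.1 = some a :: s}

/-- `P ; Q`. -/
def seq (P Q : Sem E) : Sem E where
  traces := {s | s ∈ P.traces ∧ none ∉ s} ∪
    {u | ∃ s t, s ++ [none] ∈ P.traces ∧ t ∈ Q.traces ∧ u = s ++ t}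
  failures := {f | none ∉ f.1 ∧ (f.1, f.2 ∪ {none}) ∈ P.failures} ∪
    {f | ∃ s t, s ++ [none] ∈ P.traces ∧ (t, f.2) ∈ Q.failures ∧ f.1 = s ++ t}

/-- External choice `[] x @ P x`; over an empty index it is `STOP`. -/
def extChoiceOver {ι : Type v} (P : ι → Sem E) : Sem E where
  traces := {[]} ∪ {t | ∃ x, t ∈ (P x).traces}
  failures := {f | f.1 = [] ∧ ∀ x, f ∈ (P x).failures} ∪
    {f | f.1 ≠ [] ∧ ∃ x, f ∈ (P x).failures} ∪
    {f | f.1 = [] ∧ none ∉ f.2 ∧ ∃ x, [none] ∈ (P x).traces}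

/-- `P [] Q`. -/
def extChoice (P Q : Sem E) : Sem E :=
  extChoiceOver (fun b : Bool => cond b P Q)

/-- Internal choice `|~| x @ P x`, used over nonempty index types only. -/
def intChoiceOver {ι : Type v} (P : ι → Sem E) : Sem E where
  traces := {t | ∃ x, t ∈ (P x).traces}
  failures := {f | ∃ x, f ∈ (P x).failures}

/-- `P |~| Q`. -/
def intChoice (P Q : Sem E) : Sem E :=
  intChoiceOver (fun b : Bool => cond b P Q)

/-- `P /\ Q`: at any point before its termination, `P` may be interrupted by an initial
observable action of `Q`. -/
def interrupt (P Q : Sem E) : Sem E where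
  traces := P.traces ∪
    {u | ∃ s t, s ∈ P.traces ∧ none ∉ s ∧ t ∈ Q.traces ∧ u = s ++ t}
  failures :=
    {f | f ∈ P.failures ∧ none ∉ f.1 ∧ ([], f.2) ∈ Q.failures} ∪
    {f | f.1 ++ [none] ∈ P.traces ∧ none ∉ f.2} ∪
    {f | ∃ s, s ++ [none] ∈ P.traces ∧ f.1 = s ++ [none]} ∪
    {f | ∃ s t, s ∈ P.traces ∧ none ∉ s ∧ (t, f.2) ∈ Q.failures ∧ t ≠ [] ∧ f.1 = s ++ t} ∪
    {f | f.1 ∈ P.traces ∧ none ∉ f.1 ∧ [none] ∈ Q.traces ∧ none ∉ f.2}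

open Classical in
/-- The trace `s` with the events of `H` removed. -/
noncomputable def hideTrace (H : Set E) (s : List (Obs E)) : List (Obs E) :=
  s.filter (fun x => decide (x ∉ some '' H))

/-- `P \ H`. -/
def hide (P : Sem E) (H : Set E) : Sem E where
  traces := {u | ∃ s ∈ P.traces, u = hideTrace H s}
  failures := {f | ∃ t, (t, f.2 ∪ some '' H) ∈ P.failures ∧ f.1 = hideTrace H t}

/-- The recursive process `X = F(X)`, i.e. the internal choice of all `F^n(div)`. -/
def mu (F : Sem E → Sem E) : Sem E :=
  intChoiceOver (fun n : ℕ => F^[n] DIV)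

/-- A family of mutually recursive processes `X x = F X x`. -/
def muFamily {ι : Type v} (F : (ι → Sem E) → ι → Sem E) (x : ι) : Sem E :=
  intChoiceOver (fun n : ℕ => F^[n] (fun _ => DIV) x)

end Sem

/-! ### Networks -/

/-- A network of `n` components `(A i, P i)`: `P i` is a process whose events all lie in the
alphabet `A i`. -/
structure Network (E : Type u) (n : ℕ) where
  A : Fin n → Set E
  P : Fin n → Sem E
  healthy : ∀ i, (P i).Healthy
  events_mem : ∀ i, ∀ t ∈ (P i).traces, ∀ a : E, some a ∈ t → a ∈ A i

namespace Network

variable {E : Type u} {n : ℕ} (V : Network E n)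

/-- The vocabulary: events shared by two distinct components. -/
def Voc : Set E := {a | ∃ i j, i ≠ j ∧ a ∈ V.A i ∧ a ∈ V.A j}

/-- The alphabet of the whole network. -/
def alphabet : Set E := ⋃ i, V.A i

/-- The abstract behaviour of a component: all events outside the vocabulary are hidden. -/
def Abs (i : Fin n) : Sem E := (V.P i).hide (V.Vocᶜ)

/-- Busy, non-terminating and triple disjoint. -/
structure Live : Prop where
  busy : ∀ i, (V.P i).DeadlockFree
  nonTerminating : ∀ i, (V.P i).NonTerminating
  tripleDisjoint : ∀ i j k, i ≠ j → j ≠ k → i ≠ k → V.A i ∩ V.A j ∩ V.A k = ∅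

open Classical in
/-- The restriction of a network trace to the alphabet of component `i`. -/
noncomputable def proj (i : Fin n) (s : List E) : List (Obs E) :=
  (s.filter (fun a => decide (a ∈ V.A i))).map some

/-- `(s, R)` is a state: after its part of the network trace `s`, each component `i` can stably
refuse `R i`.  The refusal sets are not required to be maximal; see
`deadlockFree_iff_maximal`. -/
def IsState (s : List E) (R : Fin n → Set (Obs E)) : Prop :=
  ∀ i, (V.proj i s, R i) ∈ (V.P i).failures

/-- States whose refusal sets are moreover maximal. -/
def IsMaximalState (s : List E) (R : Fin n → Set (Obs E)) : Prop :=
  ∀ i, Maximal (fun X => (V.proj i s, X) ∈ (V.P i).failures) (R i)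

def refusals (R : Fin n → Set (Obs E)) : Set E :=
  ⋃ i, {a | a ∈ V.A i ∧ some a ∈ R i}

/-- Every event of the network is refused. -/
def Deadlocked (R : Fin n → Set (Obs E)) : Prop :=
  V.refusals R = V.alphabet

def DeadlockFree : Prop :=
  ∀ s R, V.IsState s R → ¬ V.Deadlocked R

/-- Over a finite set of events one may equivalently look at maximal refusal sets only. -/
theorem deadlockFree_iff_maximal [Finite E] :
    V.DeadlockFree ↔ ∀ s R, V.IsMaximalState s R → ¬ V.Deadlocked R := by
  constructor
  · intro h s R hR
    exact h s R (fun i => (hR i).prop)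
  · intro h s R hR hD
    have hex : ∀ i, ∃ X, R i ⊆ X ∧
        Maximal (fun X => (V.proj i s, X) ∈ (V.P i).failures) X := fun i =>
      Set.Finite.exists_le_maximal
        (s := {X | (V.proj i s, X) ∈ (V.P i).failures}) (Set.toFinite _) (hR i)
    choose R' hsub hmax using hex
    refine h s R' hmax (Set.Subset.antisymm ?_ ?_)
    · exact Set.iUnion_mono (fun i a ha => ha.1)
    · rw [← hD]
      exact Set.iUnion_mono (fun i a ha => ⟨ha.1, hsub i ha.2⟩)

end Network

/-! ### The async-dynamic pattern -/

/-- An async-dynamic descriptor.  `send i j` and `receive i j` are channels carrying the data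
values `Data i j`, so the sets of events used to pass data from `i` to `j` are their ranges.
Only values at pairs in `C` matter.  Each transport entity links a unique pair. -/
structure AsyncDynamic (E : Type u) (n : ℕ) where
  C : Set (Fin n × Fin n)
  link : Fin n → Fin n → Fin n
  Data : Fin n → Fin n → Type v
  send : (i j : Fin n) → Data i j → E
  receive : (i j : Fin n) → Data i j → E
  turnOn : Fin n → Fin n → E
  turnOff : Fin n → Fin n → E
  timeout : Fin n → Fin n → E
  data_nonempty : ∀ i j, (i, j) ∈ C → Nonempty (Data i j)
  link_unique : ∀ i j i' j', (i, j) ∈ C → (i', j') ∈ C → link i j = link i' j' →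
    i = i' ∧ j = j'

/-- The five kinds of events used by the pattern. -/
inductive Activity
  | sending | receiving | turningOn | turningOff | timingOut

/-- States of the transport specification. -/
inductive TState (D : Type v)
  | on | onF (d : D) | off

namespace AsyncDynamic

variable {E : Type u} {n : ℕ} (M : AsyncDynamic.{u, v} E n)

def participants : Set (Fin n) := {i | ∃ j, (i, j) ∈ M.C ∨ (j, i) ∈ M.C}

def transportEntities : Set (Fin n) := {k | ∃ i j, (i, j) ∈ M.C ∧ k = M.link i j}

/-- All the events used for a given activity. -/
def events : Activity → Set E
  | .sending => {a | ∃ i j, (i, j) ∈ M.C ∧ a ∈ Set.range (M.send i j)}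
  | .receiving => {a | ∃ i j, (i, j) ∈ M.C ∧ a ∈ Set.range (M.receive i j)}
  | .turningOn => {a | ∃ i j, (i, j) ∈ M.C ∧ a = M.turnOn i j}
  | .turningOff => {a | ∃ i j, (i, j) ∈ M.C ∧ a = M.turnOff i j}
  | .timingOut => {a | ∃ i j, (i, j) ∈ M.C ∧ a = M.timeout i j}

/-- Structural compliance of a network and a descriptor.  The timeout of a link is an event of
the link and of its receiver, which may time out instead of receiving data. -/
structure StructurallyCompliant (V : Network E n) : Prop where
  partition_disjoint : M.participants ∩ M.transportEntities = ∅
  partition_cover : M.participants ∪ M.transportEntities = Set.univ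
  mutually_disjoint_events : ∀ x y, x ≠ y → M.events x ∩ M.events y = ∅
  controlled_alpha_participant : ∀ i ∈ M.participants, V.A i ∩ V.Voc =
    {a | ∃ j, (i, j) ∈ M.C ∧ a ∈ Set.range (M.send i j)} ∪
    {a | ∃ j, (j, i) ∈ M.C ∧ a ∈ Set.range (M.receive j i)} ∪
    {a | ∃ j, (i, j) ∈ M.C ∧ (a = M.turnOn i j ∨ a = M.turnOff i j)} ∪
    {a | ∃ j, (j, i) ∈ M.C ∧ a = M.timeout j i}
  controlled_alpha_transport_entity : ∀ i j, (i, j) ∈ M.C →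
    V.A (M.link i j) ∩ V.Voc =
      Set.range (M.send i j) ∪ Set.range (M.receive i j) ∪
      {M.turnOn i j, M.turnOff i j} ∪ {M.timeout i j}

open Sem

/-- The specification of the transport entity `link i j`:
```
On     = off -> Off [] send?data -> OnF(data)
OnF(d) = off -> Off [] send?data -> OnF(data) [] receive!d -> On
Off    = on -> On [] timeout -> Off
```
started in `Off`. -/
def TransportSpec (i j : Fin n) : Sem E :=
  muFamily (ι := TState (M.Data i j)) (fun X st =>
    match st with
    | .on => extChoice (pre (M.turnOff i j) (X .off))
        (extChoiceOver fun d => pre (M.send i j d) (X (.onF d)))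
    | .onF d => extChoice (pre (M.turnOff i j) (X .off))
        (extChoice (extChoiceOver fun d' => pre (M.send i j d') (X (.onF d')))
          (pre (M.receive i j d) (X .on)))
    | .off => extChoice (pre (M.turnOn i j) (X .on)) (pre (M.timeout i j) (X .off)))
    .off

open Classical in
/-- The members of the sequence `s` to which `i` has a link, in the order of `s`. -/
noncomputable def outPeers (i : Fin n) (s : List (Fin n)) : List (Fin n) :=
  s.filter (fun j => decide ((i, j) ∈ M.C))

open Classical in
/-- The members of the sequence `s` that have a link to `i`, in the order of `s`. -/
noncomputable def inPeers (i : Fin n) (s : List (Fin n)) : List (Fin n) :=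
  s.filter (fun j => decide ((j, i) ∈ M.C))

/-- Perform the processes `f j`, for `j` in the list, one after the other, then terminate. -/
def inOrder (f : Fin n → Sem E) : List (Fin n) → Sem E
  | [] => SKIP
  | j :: s => seq (f j) (inOrder f s)

/-- Signal `on` to every transport entity that has `i` as its sender. -/
noncomputable def OnDetect (i : Fin n) (s : List (Fin n)) : Sem E :=
  inOrder (fun j => pre (M.turnOn i j) SKIP) (M.outPeers i s)

/-- Signal `off` to every transport entity that has `i` as its sender. -/
noncomputable def OffDetect (i : Fin n) (s : List (Fin n)) : Sem E :=
  inOrder (fun j => pre (M.turnOff i j) SKIP) (M.outPeers i s)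

/-- Send one message, with data of the participant's own choosing, to every transport entity that
has `i` as its sender. -/
noncomputable def Send (i : Fin n) (s : List (Fin n)) : Sem E :=
  inOrder (fun j => intChoiceOver fun d => pre (M.send i j d) SKIP) (M.outPeers i s)

/-- Accept data or a timeout from every transport entity that has `i` as its receiver. -/
noncomputable def Receive (i : Fin n) (s : List (Fin n)) : Sem E :=
  inOrder (fun j => extChoice (extChoiceOver fun d => pre (M.receive j i d) SKIP)
    (pre (M.timeout j i) SKIP)) (M.inPeers i s)

/-- `SendReceive = Send ; Receive ; SendReceive`. -/
noncomputable def SendReceive (i : Fin n) (s : List (Fin n)) : Sem E :=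
  mu fun X => seq (M.Send i s) (seq (M.Receive i s) X)

/-- The specification of participant `i` with interaction sequence `s`:
`X = OnDetect ; (SendReceive /\ (SKIP |~| STOP)) ; OffDetect ; X`. -/
noncomputable def ParticipantSpec (i : Fin n) (s : List (Fin n)) : Sem E :=
  mu fun X => seq (M.OnDetect i s)
    (seq (interrupt (M.SendReceive i s) (intChoice SKIP STOP))
      (seq (M.OffDetect i s) X))

/-- Behavioural compliance, with `S i` the sequence in which participant `i` interacts with its
peers. -/
structure BehaviourallyCompliant (V : Network E n) (S : Fin n → List (Fin n)) : Prop where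
  transport : ∀ i j, (i, j) ∈ M.C → (M.TransportSpec i j).Refines (V.Abs (M.link i j))
  participant : ∀ i ∈ M.participants, (M.ParticipantSpec i (S i)).Refines (V.Abs i)
  no_repeats : ∀ i ∈ M.participants, (S i).Nodup

end AsyncDynamic

end CSP

-- In a deadlocked state every component has a failure of its specification, and an event shared by
-- a participant and a link is refused by one of the two. All that is needed from the global trace
-- is the relative order of last occurrences (`LastBefore`). Projections that keep the events
-- concerned preserve this order, so facts found in different components can be compared.
--
-- A link offers on and timeout while it is off, and off and every send while it is on; when its
-- buffer is full it also offers the receipt (`transportSpec_failures`). So no participant is stuck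
-- at an on, off or send. It can be stuck receiving from `j` only if the link from `j` is on with an
-- empty buffer: the last message was received, or the link was turned on after it. Conversely, a
-- participant stuck receiving from `j` has already sent, in the current round, to every peer it has
-- turned on, hence after its last receipt from `j` and after those peers were turned on
-- (`participantSpec_failures`).
--
-- So each participant `i` waits for a participant `f i`, which waits in turn for `f (f i)`. The
-- last receipt of `f i` from `f (f i)` precedes its last send to `i`, which precedes the last
-- receipt of `i` from `f i`. Iterating `f` gives an infinite descent of positions in a finite
-- trace.

universe w

namespace CSP

/-! ### Comparing last occurrences in a list -/

section LastPos

variable {X : Type w}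

open Classical in
/-- The number of entries of `s` up to and including the last one in `α`; `0` if there is none. -/
noncomputable def lastPos (α : Set X) (s : List X) : ℕ :=
  (s.reverse.dropWhile (fun x => decide (x ∉ α))).length

/-- Some entry of `s` lies in `β`, and no entry in `α` occurs at or after the last such entry. -/
def LastBefore (α β : Set X) (s : List X) : Prop :=
  lastPos α s < lastPos β s

theorem lastPos_nil (α : Set X) : lastPos α [] = 0 := by simp [lastPos]

theorem lastPos_le_length (α : Set X) (s : List X) : lastPos α s ≤ s.length := by
  unfold lastPos
  exact ((List.dropWhile_suffix _).length_le).trans (by simp)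

theorem lastPos_concat_of_mem {α : Set X} {x : X} (h : x ∈ α) (s : List X) :
    lastPos α (s ++ [x]) = s.length + 1 := by
  simp [lastPos, h]

theorem lastPos_concat_of_notMem {α : Set X} {x : X} (h : x ∉ α) (s : List X) :
    lastPos α (s ++ [x]) = lastPos α s := by
  simp [lastPos, h]

theorem not_lastBefore_nil (α β : Set X) : ¬ LastBefore α β [] := by
  simp [LastBefore, lastPos_nil]

/-- Read along the trace, `LastBefore` is a switch: `α` clears it, `β` sets it, anything else leaves
it alone. This recurrence drives the inductions on traces below. -/
theorem lastBefore_concat {α β : Set X} {s : List X} {x : X} :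
    LastBefore α β (s ++ [x]) ↔ x ∉ α ∧ (x ∈ β ∨ LastBefore α β s) := by
  have h1 := lastPos_le_length α s
  have h2 := lastPos_le_length β s
  unfold LastBefore
  by_cases ha : x ∈ α <;> by_cases hb : x ∈ β <;>
    simp only [lastPos_concat_of_mem, lastPos_concat_of_notMem, ha, hb, not_true, not_false_iff,
      false_and, true_and, true_or, false_or] <;> simp <;> omega

theorem lastBefore_append_iff {α β : Set X} (s : List X) {v : List X}
    (ha : ∀ x ∈ v, x ∉ α) (hb : ∀ x ∈ v, x ∉ β) :
    LastBefore α β (s ++ v) ↔ LastBefore α β s := by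
  induction v using List.reverseRecOn with
  | nil => simp
  | append_singleton v x ih =>
    rw [← List.append_assoc, lastBefore_concat,
      ih (fun y hy => ha y (by simp [hy])) (fun y hy => hb y (by simp [hy]))]
    simp [ha x (by simp), hb x (by simp)]

theorem lastBefore_append {α β : Set X} (s : List X) {v : List X}
    (ha : ∀ x ∈ v, x ∉ α) (hb : ∃ x ∈ v, x ∈ β) : LastBefore α β (s ++ v) := by
  induction v using List.reverseRecOn with
  | nil => simp at hb
  | append_singleton v x ih =>
    rw [← List.append_assoc, lastBefore_concat]
    refine ⟨ha x (by simp), ?_⟩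
    obtain ⟨y, hy, hyb⟩ := hb
    rcases List.mem_append.1 hy with hy | hy
    · exact Or.inr (ih (fun z hz => ha z (by simp [hz])) ⟨y, hy, hyb⟩)
    · obtain rfl := List.mem_singleton.1 hy
      exact Or.inl hyb

theorem not_lastBefore_append {α β : Set X} (s : List X) {v : List X}
    (ha : ∃ x ∈ v, x ∈ α) (hb : ∀ x ∈ v, x ∉ β) : ¬ LastBefore α β (s ++ v) := by
  induction v using List.reverseRecOn with
  | nil => simp at ha
  | append_singleton v x ih =>
    rw [← List.append_assoc, lastBefore_concat]
    rintro ⟨hx, hx' | h⟩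
    · exact hb x (by simp) hx'
    · obtain ⟨y, hy, hya⟩ := ha
      rcases List.mem_append.1 hy with hy | hy
      · exact ih ⟨y, hy, hya⟩ (fun z hz => hb z (by simp [hz])) h
      · obtain rfl := List.mem_singleton.1 hy
        exact hx hya

theorem lastBefore_filter_iff {α β : Set X} {p : X → Bool} (s : List X)
    (ha : ∀ x ∈ α, p x = true) (hb : ∀ x ∈ β, p x = true) :
    LastBefore α β (s.filter p) ↔ LastBefore α β s := by
  induction s using List.reverseRecOn with
  | nil => simp
  | append_singleton s x ih =>
    rw [lastBefore_concat, List.filter_append]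
    by_cases hp : p x = true
    · rw [List.filter_cons_of_pos hp, List.filter_nil, lastBefore_concat, ih]
    · have h1 : x ∉ α := fun h => hp (ha x h)
      have h2 : x ∉ β := fun h => hp (hb x h)
      simp [hp, ih, h1, h2]

end LastPos

theorem exists_mem_of_forall₂_left {X : Type*} {Y : Type*} {r : X → Y → Prop} {s : List X}
    {l : List Y} (h : List.Forall₂ r s l) : ∀ x ∈ s, ∃ y ∈ l, r x y := by
  induction h with
  | nil => simp
  | cons h _ ih => simpa using ⟨Or.inl h, fun a ha => Or.inr (ih a ha)⟩

theorem exists_mem_of_forall₂_right {X : Type*} {Y : Type*} {r : X → Y → Prop} {s : List X}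
    {l : List Y} (h : List.Forall₂ r s l) : ∀ y ∈ l, ∃ x ∈ s, r x y := by
  induction h with
  | nil => simp
  | cons h _ ih => simpa using ⟨Or.inl h, fun a ha => Or.inr (ih a ha)⟩

/-! ### Sequences of one-event processes -/

namespace Sem

variable {E : Type u}

/-- `P` performs one event of `G` and terminates; while it waits, its refusals satisfy `O`. -/
structure SingleEvent (P : Sem E) (G : Set (Obs E)) (O : Set (Obs E) → Prop) : Prop where
  tick_notMem : none ∉ G
  traces_eq : ∀ t ∈ P.traces, t = [] ∨ ∃ e ∈ G, t = [e] ∨ t = [e, none]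
  offer : ∀ t Y, (t, Y) ∈ P.failures → none ∉ t → none ∈ Y → t = [] ∧ O Y

theorem SingleEvent.eq_of_terminated {P : Sem E} {G : Set (Obs E)} {O : Set (Obs E) → Prop}
    (h : P.SingleEvent G O) {s : List (Obs E)} (hs : s ++ [none] ∈ P.traces) :
    ∃ e ∈ G, s = [e] := by
  rcases h.traces_eq _ hs with h0 | ⟨e, he, h1 | h2⟩
  · simp at h0
  · cases s with
    | nil =>
      have h1 : none = e := by simpa using h1
      exact absurd (h1 ▸ he) h.tick_notMem
    | cons a s => simp at h1
  · have h2 : s ++ [none] = [e] ++ [none] := h2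
    exact ⟨e, he, List.append_cancel_right h2⟩

variable {n : ℕ} {f : Fin n → Sem E} {G : Fin n → Set (Obs E)}
  {O : Fin n → Set (Obs E) → Prop}

open AsyncDynamic

theorem inOrder_terminated (l : List (Fin n)) (hf : ∀ j ∈ l, (f j).SingleEvent (G j) (O j)) :
    ∀ s, s ++ [none] ∈ (inOrder f l).traces → List.Forall₂ (fun e j => e ∈ G j) s l := by
  induction l with
  | nil =>
    intro s hs
    have : s = [] := by simpa [inOrder, SKIP] using hs
    simp [this]
  | cons j l ih =>
    intro s hs
    rcases hs with ⟨-, h⟩ | ⟨s', t, hs', ht, heq⟩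
    · simp at h
    · obtain ⟨e, he, rfl⟩ := (hf j (by simp)).eq_of_terminated hs'
      cases s with
      | nil =>
        have : none = e ∧ [] = t := by simpa using heq
        exact absurd (this.1 ▸ he) (hf j (by simp)).tick_notMem
      | cons a s =>
        have h : a = e ∧ s ++ [none] = t := by simpa using heq
        obtain ⟨rfl, rfl⟩ := h
        exact .cons he (ih (fun k hk => hf k (by simp [hk])) s ht)

theorem inOrder_traces (l : List (Fin n)) (hf : ∀ j ∈ l, (f j).SingleEvent (G j) (O j)) :
    ∀ t ∈ (inOrder f l).traces, ∀ x ∈ t, x = none ∨ ∃ j ∈ l, x ∈ G j := by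
  induction l with
  | nil =>
    rintro t (rfl | rfl) x hx
    · simp at hx
    · exact Or.inl (by simpa using hx)
  | cons j l ih =>
    rintro t (⟨ht, hn⟩ | ⟨s', t', hs', ht, rfl⟩) x hx
    · rcases (hf j (by simp)).traces_eq t ht with rfl | ⟨e, he, rfl | rfl⟩
      · simp at hx
      · obtain rfl := List.mem_singleton.1 hx
        exact Or.inr ⟨j, by simp, he⟩
      · simp at hn
    · obtain ⟨e, he, rfl⟩ := (hf j (by simp)).eq_of_terminated hs'
      rcases List.mem_append.1 hx with hx | hx
      · obtain rfl := List.mem_singleton.1 hx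
        exact Or.inr ⟨j, by simp, he⟩
      · rcases ih (fun k hk => hf k (by simp [hk])) t' ht x hx with h | ⟨k, hk, h⟩
        · exact Or.inl h
        · exact Or.inr ⟨k, by simp [hk], h⟩

/-- The final `SKIP` cannot refuse the tick before performing it. A refusal containing the tick
therefore means being stuck at a definite entry, every earlier entry having contributed exactly one
event. -/
theorem inOrder_failures (l : List (Fin n)) (hf : ∀ j ∈ l, (f j).SingleEvent (G j) (O j)) :
    ∀ t Y, (t, Y) ∈ (inOrder f l).failures → none ∉ t → none ∈ Y →
      ∃ l₁ j l₂, l = l₁ ++ j :: l₂ ∧ List.Forall₂ (fun e k => e ∈ G k) t l₁ ∧ O j Y := by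
  induction l with
  | nil =>
    rintro t Y (⟨-, h⟩ | h) hn hY
    · exact absurd hY h
    · have h : t = [none] := h
      simp [h] at hn
  | cons j l ih =>
    rintro t Y (⟨-, h⟩ | ⟨s', t', hs', ht, heq⟩) hn hY
    -- `seq` asks its left part to refuse the tick as well; `Y` already contains it.
    · have hYY : Y ∪ {none} = Y := by simpa using hY
      simp only [hYY] at h
      obtain ⟨rfl, hO⟩ := (hf j (by simp)).offer t Y h hn hY
      exact ⟨[], j, l, rfl, .nil, hO⟩
    · obtain ⟨e, he, rfl⟩ := (hf j (by simp)).eq_of_terminated hs'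
      have heq : t = e :: t' := heq
      subst heq
      obtain ⟨l₁, k, l₂, rfl, h2, h3⟩ := ih (fun k hk => hf k (by simp [hk])) t' Y ht
        (fun h => hn (by simp [h])) hY
      exact ⟨j :: l₁, k, l₂, rfl, .cons he h2, h3⟩

theorem singleEvent_pre_skip (a : E) :
    (pre a SKIP).SingleEvent {some a} (fun Y => some a ∉ Y) where
  tick_notMem := by simp
  traces_eq := by
    rintro t (rfl | ⟨s, rfl | rfl, rfl⟩) <;> simp
  offer := by
    rintro t Y (⟨h, h'⟩ | ⟨s, ⟨h, h'⟩ | h, h2⟩) hn hY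
    · exact ⟨h, h'⟩
    · exact absurd hY h'
    · have h : s = [none] := h
      have h2 : t = some a :: s := h2
      simp [h2, h] at hn

theorem singleEvent_intChoiceOver_pre_skip {D : Type v} (a : D → E) :
    (intChoiceOver fun d => pre (a d) SKIP).SingleEvent (some '' Set.range a)
      (fun Y => ∃ d, some (a d) ∉ Y) where
  tick_notMem := by simp
  traces_eq := by
    rintro t ⟨d, hd⟩
    rcases (singleEvent_pre_skip (a d)).traces_eq t hd with h | ⟨e, rfl, h⟩
    · exact Or.inl h
    · exact Or.inr ⟨_, ⟨a d, ⟨d, rfl⟩, rfl⟩, h⟩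
  offer := by
    rintro t Y ⟨d, hd⟩ hn hY
    obtain ⟨h1, h2⟩ := (singleEvent_pre_skip (a d)).offer t Y hd hn hY
    exact ⟨h1, d, h2⟩

/-- An external choice of one-event processes waits until all of them are offered. -/
theorem singleEvent_extChoiceOver {ι : Type v} {P : ι → Sem E} {G : ι → Set (Obs E)}
    {O : ι → Set (Obs E) → Prop} (h : ∀ x, (P x).SingleEvent (G x) (O x)) :
    (extChoiceOver P).SingleEvent (⋃ x, G x) (fun Y => ∀ x, O x Y) where
  tick_notMem := by simpa using fun x => (h x).tick_notMem
  traces_eq := by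
    rintro t (rfl | ⟨x, hx⟩)
    · exact Or.inl rfl
    · rcases (h x).traces_eq t hx with h | ⟨e, he, h⟩
      · exact Or.inl h
      · exact Or.inr ⟨e, Set.mem_iUnion.2 ⟨x, he⟩, h⟩
  offer := by
    rintro t Y ((⟨ht, h'⟩ | ⟨ht, x, hx⟩) | ⟨-, h', -⟩) hn hY
    · exact ⟨ht, fun x => ((h x).offer t Y (h' x) hn hY).2⟩
    · exact absurd ((h x).offer t Y hx hn hY).1 ht
    · exact absurd hY h'

theorem SingleEvent.mono {P : Sem E} {G G' : Set (Obs E)} {O O' : Set (Obs E) → Prop}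
    (h : P.SingleEvent G O) (hG : G ⊆ G') (hn : none ∉ G') (hO : ∀ Y, O Y → O' Y) :
    P.SingleEvent G' O' where
  tick_notMem := hn
  traces_eq := fun t ht => (h.traces_eq t ht).imp_right fun ⟨e, he, h'⟩ => ⟨e, hG he, h'⟩
  offer := fun t Y h1 h2 h3 => (h.offer t Y h1 h2 h3).imp_right (hO Y)

end Sem

/-! ### Events of a pair and their separation -/

namespace AsyncDynamic

open Sem

variable {E : Type u} {n : ℕ} (M : AsyncDynamic.{u, v} E n)

/-- The observations by which the pair `(i, j)` performs a given activity. -/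
def pairEvents : Activity → Fin n → Fin n → Set (Obs E)
  | .sending, i, j => some '' Set.range (M.send i j)
  | .receiving, i, j => some '' Set.range (M.receive i j)
  | .turningOn, i, j => {some (M.turnOn i j)}
  | .turningOff, i, j => {some (M.turnOff i j)}
  | .timingOut, i, j => {some (M.timeout i j)}

theorem none_notMem_pairEvents (k : Activity) (i j : Fin n) : none ∉ M.pairEvents k i j := by
  cases k <;> simp [pairEvents]

/-- An event determines its activity and the pair it belongs to. -/
def Separated : Prop :=
  ∀ ⦃k k' : Activity⦄ ⦃i j i' j' : Fin n⦄ ⦃x : Obs E⦄, (i, j) ∈ M.C → (i', j') ∈ M.C →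
    x ∈ M.pairEvents k i j → x ∈ M.pairEvents k' i' j' → k = k' ∧ i = i' ∧ j = j'

/-- The participant that takes part in an activity of the pair `(i, j)`. -/
def owner : Activity → Fin n → Fin n → Fin n
  | .sending, i, _ | .turningOn, i, _ | .turningOff, i, _ => i
  | .receiving, _, j | .timingOut, _, j => j

variable {M} {V : Network E n}

theorem owner_mem_participants (k : Activity) {i j : Fin n} (hC : (i, j) ∈ M.C) :
    owner k i j ∈ M.participants := by
  cases k
  exacts [⟨j, Or.inl hC⟩, ⟨i, Or.inr hC⟩, ⟨j, Or.inl hC⟩, ⟨j, Or.inl hC⟩, ⟨i, Or.inr hC⟩]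

namespace StructurallyCompliant

theorem mem_link (h : M.StructurallyCompliant V) {k : Activity} {i j : Fin n}
    (hC : (i, j) ∈ M.C) {a : E} (ha : some a ∈ M.pairEvents k i j) :
    a ∈ V.A (M.link i j) ∩ V.Voc := by
  rw [h.controlled_alpha_transport_entity i j hC]
  cases k <;> simp [pairEvents] at ha ⊢ <;> simp [ha]

theorem mem_owner (h : M.StructurallyCompliant V) {k : Activity} {i j : Fin n}
    (hC : (i, j) ∈ M.C) {a : E} (ha : some a ∈ M.pairEvents k i j) :
    a ∈ V.A (owner k i j) ∩ V.Voc := by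
  rw [h.controlled_alpha_participant _ (owner_mem_participants k hC)]
  cases k <;> simp only [pairEvents, owner] at ha ⊢
  · exact Or.inl (Or.inl (Or.inl ⟨j, hC, by simpa using ha⟩))
  · exact Or.inl (Or.inl (Or.inr ⟨i, hC, by simpa using ha⟩))
  · exact Or.inl (Or.inr ⟨j, hC, Or.inl (by simpa using ha)⟩)
  · exact Or.inl (Or.inr ⟨j, hC, Or.inr (by simpa using ha)⟩)
  · exact Or.inr ⟨i, hC, by simpa using ha⟩

theorem owner_ne_link (h : M.StructurallyCompliant V) (k : Activity) {i j i' j' : Fin n}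
    (hC : (i, j) ∈ M.C) (hC' : (i', j') ∈ M.C) : owner k i j ≠ M.link i' j' := by
  intro he
  have : owner k i j ∈ M.participants ∩ M.transportEntities :=
    ⟨owner_mem_participants k hC, i', j', hC', he⟩
  rw [h.partition_disjoint] at this
  exact this

/-- Disjointness of the five event sets fixes the activity. An event of two different pairs would
lie in its owner and in two different links, against triple disjointness. -/
theorem separated (h : M.StructurallyCompliant V) (hV : V.Live) : M.Separated := by
  intro k k' i j i' j' x hC hC' hx hx'
  cases x with
  | none => exact absurd hx (M.none_notMem_pairEvents k i j)
  | some a =>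
    have key : ∀ {k i j}, (i, j) ∈ M.C → some a ∈ M.pairEvents k i j → a ∈ M.events k := by
      intro k i j hC ha
      cases k <;> exact ⟨i, j, hC, by simpa [pairEvents] using ha⟩
    refine ⟨?_, ?_⟩
    · by_contra hne
      have : a ∈ M.events k ∩ M.events k' := ⟨key hC hx, key hC' hx'⟩
      rw [h.mutually_disjoint_events k k' hne] at this
      exact this
    · apply M.link_unique i j i' j' hC hC'
      by_contra hne
      have : a ∈ V.A (owner k i j) ∩ V.A (M.link i j) ∩ V.A (M.link i' j') :=
        ⟨⟨(h.mem_owner hC hx).1, (h.mem_link hC hx).1⟩, (h.mem_link hC' hx').1⟩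
      rw [hV.tripleDisjoint _ _ _ (h.owner_ne_link k hC hC) hne (h.owner_ne_link k hC hC')] at this
      exact this

end StructurallyCompliant

/-! ### Failures of the transport specification -/

/-- The pair `(i, j)` was turned on after it was last turned off. -/
def IsOn (M : AsyncDynamic.{u, v} E n) (i j : Fin n) (t : List (Obs E)) : Prop :=
  LastBefore (M.pairEvents .turningOff i j) (M.pairEvents .turningOn i j) t

/-- What the trace `t` says about a link that is in a given state after it. -/
def TraceOf (M : AsyncDynamic.{u, v} E n) (i j : Fin n) (t : List (Obs E)) :
    TState (M.Data i j) → Prop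
  | .off => ¬ M.IsOn i j t
  | .onF _ => M.IsOn i j t
  | .on => M.IsOn i j t ∧
      (LastBefore (M.pairEvents .sending i j) (M.pairEvents .receiving i j) t ∨
        LastBefore (M.pairEvents .sending i j) (M.pairEvents .turningOn i j) t)

/-- None of the events offered by a link in the given state is in `Y`. -/
def Offers (M : AsyncDynamic.{u, v} E n) (i j : Fin n) (Y : Set (Obs E)) :
    TState (M.Data i j) → Prop
  | .off => some (M.turnOn i j) ∉ Y ∧ some (M.timeout i j) ∉ Y
  | .on => some (M.turnOff i j) ∉ Y ∧ ∀ d, some (M.send i j d) ∉ Y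
  | .onF d => some (M.turnOff i j) ∉ Y ∧ (∀ d, some (M.send i j d) ∉ Y) ∧
      some (M.receive i j d) ∉ Y

section Choice

variable {P Q : Sem E} {t : List (Obs E)} {Y : Set (Obs E)}

theorem mem_failures_extChoice (h : (t, Y) ∈ (extChoice P Q).failures)
    (hP : [none] ∉ P.traces) (hQ : [none] ∉ Q.traces) :
    (t = [] ∧ (t, Y) ∈ P.failures ∧ (t, Y) ∈ Q.failures) ∨
      (t ≠ [] ∧ ((t, Y) ∈ P.failures ∨ (t, Y) ∈ Q.failures)) := by
  rcases h with (⟨ht, h⟩ | ⟨ht, b, hb⟩) | ⟨-, -, b, hb⟩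
  · exact Or.inl ⟨ht, h true, h false⟩
  · cases b
    · exact Or.inr ⟨ht, Or.inr hb⟩
    · exact Or.inr ⟨ht, Or.inl hb⟩
  · cases b
    · exact absurd hb hQ
    · exact absurd hb hP

theorem mem_failures_extChoiceOver {ι : Type v} {P : ι → Sem E}
    (h : (t, Y) ∈ (extChoiceOver P).failures) (hP : ∀ x, [none] ∉ (P x).traces) :
    (t = [] ∧ ∀ x, (t, Y) ∈ (P x).failures) ∨ (t ≠ [] ∧ ∃ x, (t, Y) ∈ (P x).failures) := by
  rcases h with (h | h) | ⟨-, -, b, hb⟩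
  · exact Or.inl h
  · exact Or.inr h
  · exact absurd hb (hP b)

theorem mem_failures_pre {a : E} (h : (t, Y) ∈ (pre a P).failures) :
    (t = [] ∧ some a ∉ Y) ∨ ∃ s, t = some a :: s ∧ (s, Y) ∈ P.failures := by
  rcases h with h | ⟨s, h, h'⟩
  · exact Or.inl h
  · exact Or.inr ⟨s, h', h⟩

theorem tick_notMem_traces_pre {a : E} : [none] ∉ (pre a P).traces := by
  simp [pre]

theorem tick_notMem_traces_extChoiceOver {ι : Type v} {P : ι → Sem E}
    (hP : ∀ x, [none] ∉ (P x).traces) : [none] ∉ (extChoiceOver P).traces := by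
  simpa [extChoiceOver] using hP

theorem tick_notMem_traces_extChoice (hP : [none] ∉ P.traces) (hQ : [none] ∉ Q.traces) :
    [none] ∉ (extChoice P Q).traces :=
  tick_notMem_traces_extChoiceOver (by rintro (_ | _) <;> assumption)

end Choice

theorem Separated.notMem (h : M.Separated) {k k' : Activity} {i j : Fin n} (hC : (i, j) ∈ M.C)
    (hk : k ≠ k') {x : Obs E} (hx : x ∈ M.pairEvents k i j) : x ∉ M.pairEvents k' i j :=
  fun hx' => hk (h hC hC hx hx').1

theorem Separated.isOn_concat (h : M.Separated) {k : Activity} {i j : Fin n}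
    (hC : (i, j) ∈ M.C) (h1 : k ≠ .turningOn) (h2 : k ≠ .turningOff) {x : Obs E}
    (hx : x ∈ M.pairEvents k i j) (t : List (Obs E)) :
    M.IsOn i j (t ++ [x]) ↔ M.IsOn i j t :=
  lastBefore_append_iff t (by simpa using h.notMem hC h2 hx) (by simpa using h.notMem hC h1 hx)

/-- `TraceOf` is an invariant of the transitions. State `on` is entered by a receipt or by turning
on, which gives its two alternatives; a timeout does not affect `IsOn`. -/
theorem transportSpec_failures (hsep : M.Separated) {i j : Fin n} (hC : (i, j) ∈ M.C)
    {t : List (Obs E)} {Y : Set (Obs E)} (h : (t, Y) ∈ (M.TransportSpec i j).failures) :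
    ∃ st, M.TraceOf i j t st ∧ M.Offers i j Y st := by
  have hon : some (M.turnOn i j) ∈ M.pairEvents .turningOn i j := rfl
  have hoff : some (M.turnOff i j) ∈ M.pairEvents .turningOff i j := rfl
  have htim : some (M.timeout i j) ∈ M.pairEvents .timingOut i j := rfl
  have hsnd : ∀ d, some (M.send i j d) ∈ M.pairEvents .sending i j := fun d => ⟨_, ⟨d, rfl⟩, rfl⟩
  have hrcv : ∀ d, some (M.receive i j d) ∈ M.pairEvents .receiving i j :=
    fun d => ⟨_, ⟨d, rfl⟩, rfl⟩
  have toOff : ∀ p, M.TraceOf i j (p ++ [some (M.turnOff i j)]) .off :=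
    fun p => not_lastBefore_append p ⟨_, by simp, hoff⟩
      (by simpa using hsep.notMem hC (by simp) hoff)
  have toOn : ∀ p, M.TraceOf i j (p ++ [some (M.turnOn i j)]) .on := fun p =>
    ⟨lastBefore_append p (by simpa using hsep.notMem hC (by simp) hon) ⟨_, by simp, hon⟩,
      Or.inr (lastBefore_append p (by simpa using hsep.notMem hC (by simp) hon) ⟨_, by simp, hon⟩)⟩
  have toOnF : ∀ p d, M.IsOn i j p → M.TraceOf i j (p ++ [some (M.send i j d)]) (.onF d) :=
    fun p d hp => (hsep.isOn_concat hC (by simp) (by simp) (hsnd d) p).2 hp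
  have toOn' : ∀ p d, M.IsOn i j p → M.TraceOf i j (p ++ [some (M.receive i j d)]) .on :=
    fun p d hp => ⟨(hsep.isOn_concat hC (by simp) (by simp) (hrcv d) p).2 hp,
      Or.inl (lastBefore_append p (by simpa using hsep.notMem hC (by simp) (hrcv d))
        ⟨_, by simp, hrcv d⟩)⟩
  obtain ⟨m, hm⟩ := h
  -- Each unfolding may restart in another state, while `TraceOf` speaks of the whole history; hence
  -- an arbitrary state and an accumulated past `p`. The base case is void because `DIV` has no
  -- failures.
  suffices H : ∀ (m : ℕ) (st : TState (M.Data i j)) (p t : List (Obs E)), M.TraceOf i j p st →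
      (t, Y) ∈ ((fun (X : TState (M.Data i j) → Sem E) st =>
        match st with
        | .on => extChoice (pre (M.turnOff i j) (X .off))
            (extChoiceOver fun d => pre (M.send i j d) (X (.onF d)))
        | .onF d => extChoice (pre (M.turnOff i j) (X .off))
            (extChoice (extChoiceOver fun d' => pre (M.send i j d') (X (.onF d')))
              (pre (M.receive i j d) (X .on)))
        | .off => extChoice (pre (M.turnOn i j) (X .on)) (pre (M.timeout i j) (X .off)))^[m]
          (fun _ => DIV) st).failures →
      ∃ st, M.TraceOf i j (p ++ t) st ∧ M.Offers i j Y st by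
    exact H m .off [] t (not_lastBefore_nil _ _) hm
  clear hm m t
  intro m
  induction m with
  | zero => exact fun st p t _ h => absurd h (Set.notMem_empty _)
  | succ m ih =>
    intro st p t hp h
    rw [Function.iterate_succ_apply'] at h
    generalize Nat.iterate _ m _ = Z at ih h
    have step : ∀ (st : TState (M.Data i j)) (x : Obs E) (t : List (Obs E)),
        M.TraceOf i j (p ++ [x]) st → (t, Y) ∈ (Z st).failures →
        ∃ st, M.TraceOf i j (p ++ x :: t) st ∧ M.Offers i j Y st := by
      intro st x t h1 h2
      simpa using ih st (p ++ [x]) t h1 h2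
    have hsendTick : [none] ∉ (extChoiceOver
        fun d => pre (M.send i j d) (Z (.onF d))).traces :=
      tick_notMem_traces_extChoiceOver fun _ => tick_notMem_traces_pre
    have sendCase : ∀ {t : List (Obs E)}, M.IsOn i j p → t ≠ [] →
        (t, Y) ∈ (extChoiceOver fun d => pre (M.send i j d) (Z (.onF d))).failures →
        ∃ st, M.TraceOf i j (p ++ t) st ∧ M.Offers i j Y st := by
      intro t hp hne h
      rcases mem_failures_extChoiceOver h fun _ => tick_notMem_traces_pre with
        ⟨h0, -⟩ | ⟨-, d, h⟩
      · exact absurd h0 hne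
      · rcases mem_failures_pre h with ⟨h0, -⟩ | ⟨s, rfl, hs⟩
        · exact absurd h0 hne
        · exact step _ _ _ (toOnF p d hp) hs
    have sendOffer : ([], Y) ∈ (extChoiceOver fun d => pre (M.send i j d) (Z (.onF d))).failures →
        ∀ d, some (M.send i j d) ∉ Y := by
      intro h d
      rcases mem_failures_extChoiceOver h fun _ => tick_notMem_traces_pre with ⟨-, h⟩ | ⟨h0, -⟩
      · rcases mem_failures_pre (h d) with ⟨-, h⟩ | ⟨s, h, -⟩
        · exact h
        · simp at h
      · exact absurd rfl h0
    have preCase : ∀ {t : List (Obs E)} {a : E} {st : TState (M.Data i j)},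
        M.TraceOf i j (p ++ [some a]) st → t ≠ [] → (t, Y) ∈ (pre a (Z st)).failures →
        ∃ st, M.TraceOf i j (p ++ t) st ∧ M.Offers i j Y st := by
      intro t a st hp hne h
      rcases mem_failures_pre h with ⟨h0, -⟩ | ⟨s, rfl, hs⟩
      · exact absurd h0 hne
      · exact step _ _ _ hp hs
    have preOffer : ∀ {a : E} {P : Sem E}, ([], Y) ∈ (pre a P).failures → some a ∉ Y := by
      intro a P h
      rcases mem_failures_pre h with ⟨-, h⟩ | ⟨s, h, -⟩
      · exact h
      · simp at h
    cases st with
    | on =>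
      rcases mem_failures_extChoice h tick_notMem_traces_pre hsendTick with
        ⟨rfl, h1, h2⟩ | ⟨hne, h | h⟩
      · exact ⟨.on, by simpa using hp, preOffer h1, sendOffer h2⟩
      · exact preCase (toOff p) hne h
      · exact sendCase hp.1 hne h
    | onF d =>
      rcases mem_failures_extChoice h tick_notMem_traces_pre
        (tick_notMem_traces_extChoice hsendTick tick_notMem_traces_pre) with
        ⟨rfl, h1, h2⟩ | ⟨hne, h | h⟩
      · rcases mem_failures_extChoice h2 hsendTick tick_notMem_traces_pre with
          ⟨-, h2, h3⟩ | ⟨h0, -⟩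
        · exact ⟨.onF d, by simpa using hp, preOffer h1, sendOffer h2, preOffer h3⟩
        · exact absurd rfl h0
      · exact preCase (toOff p) hne h
      · rcases mem_failures_extChoice h hsendTick tick_notMem_traces_pre with
          ⟨h0, -⟩ | ⟨-, h | h⟩
        · exact absurd h0 hne
        · exact sendCase hp hne h
        · exact preCase (toOn' p d hp) hne h
    | off =>
      rcases mem_failures_extChoice h tick_notMem_traces_pre tick_notMem_traces_pre with
        ⟨rfl, h1, h2⟩ | ⟨hne, h | h⟩
      · exact ⟨.off, by simpa using hp, preOffer h1, preOffer h2⟩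
      · exact preCase (toOn p) hne h
      · exact preCase (st := .off)
          (fun h' => hp ((hsep.isOn_concat hC (by simp) (by simp) htim p).1 h')) hne h

/-! ### Failures of the participant specification -/

theorem mem_outPeers {i j : Fin n} {l : List (Fin n)} :
    j ∈ M.outPeers i l ↔ j ∈ l ∧ (i, j) ∈ M.C := by simp [outPeers]

theorem mem_inPeers {i j : Fin n} {l : List (Fin n)} :
    j ∈ M.inPeers i l ↔ j ∈ l ∧ (j, i) ∈ M.C := by simp [inPeers]

/-- What participant `i` is waiting for after the trace `t` when it stably refuses `Y`.  When it
waits for data from `j`, it has sent to each of its peers since that peer was turned on and since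
it last received from `j`. -/
inductive Waiting (M : AsyncDynamic.{u, v} E n) (i : Fin n) (t : List (Obs E))
    (Y : Set (Obs E)) : Prop
  | turnOn (j : Fin n) (hC : (i, j) ∈ M.C) (hY : some (M.turnOn i j) ∉ Y)
      (ht : ¬ M.IsOn i j t)
  | turnOff (j : Fin n) (hC : (i, j) ∈ M.C) (hY : some (M.turnOff i j) ∉ Y)
      (ht : M.IsOn i j t)
  | send (j : Fin n) (hC : (i, j) ∈ M.C) (d : M.Data i j) (hY : some (M.send i j d) ∉ Y)
      (ht : M.IsOn i j t)
  | receive (j : Fin n) (hC : (j, i) ∈ M.C) (hY : ∀ d, some (M.receive j i d) ∉ Y)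
      (hY' : some (M.timeout j i) ∉ Y)
      (ht : ∀ h, (i, h) ∈ M.C → M.IsOn i h t →
        LastBefore (M.pairEvents .receiving j i) (M.pairEvents .sending i h) t ∧
        LastBefore (M.pairEvents .turningOn i h) (M.pairEvents .sending i h) t)

/-- The observations by which participant `i` exchanges data. -/
def dataEvents (M : AsyncDynamic.{u, v} E n) (i : Fin n) : Set (Obs E) :=
  {x | (∃ j, (i, j) ∈ M.C ∧ x ∈ M.pairEvents .sending i j) ∨
    ∃ j, (j, i) ∈ M.C ∧ x ∈ M.pairEvents .receiving j i ∪ M.pairEvents .timingOut j i}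

theorem none_notMem_dataEvents (i : Fin n) : none ∉ M.dataEvents i := by
  rintro (⟨j, -, h⟩ | ⟨j, -, h | h⟩) <;> exact M.none_notMem_pairEvents _ _ _ h

theorem Separated.isOn_append (hsep : M.Separated) {i j : Fin n} (hC : (i, j) ∈ M.C)
    (p : List (Obs E)) {v : List (Obs E)} (hv : ∀ x ∈ v, x ∈ M.dataEvents i) :
    M.IsOn i j (p ++ v) ↔ M.IsOn i j p := by
  refine lastBefore_append_iff p ?_ ?_ <;> intro x hx hx' <;>
    rcases hv x hx with ⟨k, hk, h⟩ | ⟨k, hk, h | h⟩ <;>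
    exact Activity.noConfusion (hsep hC hk hx' h).1

theorem singleEvent_receive (i j : Fin n) :
    (extChoice (extChoiceOver fun d => pre (M.receive j i d) SKIP)
      (pre (M.timeout j i) SKIP)).SingleEvent
      (M.pairEvents .receiving j i ∪ M.pairEvents .timingOut j i)
      (fun Y => (∀ d, some (M.receive j i d) ∉ Y) ∧ some (M.timeout j i) ∉ Y) := by
  have h : (extChoice (extChoiceOver fun d => pre (M.receive j i d) SKIP)
      (pre (M.timeout j i) SKIP)).SingleEvent _ _ :=
    singleEvent_extChoiceOver (ι := Bool)
      (G := fun b => cond b (⋃ d, {some (M.receive j i d)}) {some (M.timeout j i)})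
      (O := fun b Y => cond b (∀ d, some (M.receive j i d) ∉ Y) (some (M.timeout j i) ∉ Y))
      (by
        rintro (_ | _)
        · exact singleEvent_pre_skip _
        · exact singleEvent_extChoiceOver fun d => singleEvent_pre_skip _)
  refine h.mono ?_ ?_ fun Y hY => ⟨hY true, hY false⟩
  · intro x hx
    obtain ⟨b, hb⟩ := Set.mem_iUnion.1 hx
    cases b
    · exact Or.inr hb
    · obtain ⟨d, hd⟩ := Set.mem_iUnion.1 hb
      exact Or.inl ⟨_, ⟨d, rfl⟩, hd.symm⟩
  · rintro (h | h) <;> exact M.none_notMem_pairEvents _ _ _ h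

theorem send_terminated {i : Fin n} {l : List (Fin n)} {s : List (Obs E)}
    (h : s ++ [none] ∈ (M.Send i l).traces) :
    List.Forall₂ (fun e j => e ∈ M.pairEvents .sending i j) s (M.outPeers i l) :=
  inOrder_terminated _ (fun j _ => singleEvent_intChoiceOver_pre_skip (M.send i j)) s h

theorem receive_terminated {i : Fin n} {l : List (Fin n)} {s : List (Obs E)}
    (h : s ++ [none] ∈ (M.Receive i l).traces) :
    List.Forall₂ (fun e j => e ∈ M.pairEvents .receiving j i ∪ M.pairEvents .timingOut j i) s
      (M.inPeers i l) :=
  inOrder_terminated _ (fun j _ => singleEvent_receive i j) s h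

theorem dataEvents_of_send {i : Fin n} {l l' : List (Fin n)} {s : List (Obs E)}
    (h : List.Forall₂ (fun e j => e ∈ M.pairEvents .sending i j) s l')
    (hl : ∀ j ∈ l', j ∈ M.outPeers i l) : ∀ x ∈ s, x ∈ M.dataEvents i := by
  intro x hx
  obtain ⟨j, hj, hxj⟩ := exists_mem_of_forall₂_left h x hx
  exact Or.inl ⟨j, (mem_outPeers.1 (hl j hj)).2, hxj⟩

theorem dataEvents_of_receive {i : Fin n} {l l' : List (Fin n)} {s : List (Obs E)}
    (h : List.Forall₂
      (fun e j => e ∈ M.pairEvents .receiving j i ∪ M.pairEvents .timingOut j i) s l')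
    (hl : ∀ j ∈ l', j ∈ M.inPeers i l) : ∀ x ∈ s, x ∈ M.dataEvents i := by
  intro x hx
  obtain ⟨j, hj, hxj⟩ := exists_mem_of_forall₂_left h x hx
  exact Or.inr ⟨j, (mem_inPeers.1 (hl j hj)).2, hxj⟩

/-- Two consequences matter: the loop changes no on/off status, and it never terminates by itself.
-/
theorem sendReceive_traces {i : Fin n} {l : List (Fin n)} {t : List (Obs E)}
    (h : t ∈ (M.SendReceive i l).traces) : ∀ x ∈ t, x ∈ M.dataEvents i := by
  obtain ⟨m, hm⟩ := h
  dsimp only at hm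
  induction m generalizing t with
  | zero =>
    have : t = [] := hm
    simp [this]
  | succ m ih =>
    rw [Function.iterate_succ_apply'] at hm
    rcases hm with ⟨ht, hn⟩ | ⟨s, t, hs, ht, rfl⟩
    · intro x hx
      rcases inOrder_traces _ (fun j _ => singleEvent_intChoiceOver_pre_skip (M.send i j)) t ht x hx
        with rfl | ⟨j, hj, hxj⟩
      · exact absurd hx hn
      · exact Or.inl ⟨j, (mem_outPeers.1 hj).2, hxj⟩
    · have h1 := dataEvents_of_send (send_terminated hs) fun _ => id
      suffices h2 : ∀ x ∈ t, x ∈ M.dataEvents i from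
        fun x hx => (List.mem_append.1 hx).elim (h1 x) (h2 x)
      rcases ht with ⟨ht, hn⟩ | ⟨s', t', hs', ht', rfl⟩
      · intro x hx
        rcases inOrder_traces _ (fun j _ => singleEvent_receive i j) t ht x hx
          with rfl | ⟨j, hj, hxj⟩
        · exact absurd hx hn
        · exact Or.inr ⟨j, (mem_inPeers.1 hj).2, hxj⟩
      · have h2 := dataEvents_of_receive (receive_terminated hs') fun _ => id
        exact fun x hx => (List.mem_append.1 hx).elim (h2 x) (ih ht' x)

/-- The past `p` absorbs completed rounds. A participant stuck in `Receive` has finished the `Send`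
of the same round, so each active peer was sent to after `p`. The links that are on are exactly
those to `outPeers`, since peers missing from the sequence are never turned on. -/
theorem sendReceive_failures (hsep : M.Separated) {i : Fin n} {l : List (Fin n)} (hl : l.Nodup)
    {Y : Set (Obs E)} (hY : none ∈ Y) {p t : List (Obs E)}
    (hp : ∀ h, (i, h) ∈ M.C → (M.IsOn i h p ↔ h ∈ M.outPeers i l)) (hn : none ∉ t)
    (h : (t, Y) ∈ (M.SendReceive i l).failures) : M.Waiting i (p ++ t) Y := by
  obtain ⟨m, hm⟩ := h
  dsimp only at hm
  have hYY : Y ∪ {none} = Y := by simpa using hY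
  induction m generalizing p t with
  | zero => exact absurd hm (Set.notMem_empty _)
  | succ m ih =>
    rw [Function.iterate_succ_apply'] at hm
    rcases hm with ⟨-, ht⟩ | ⟨s, t', hs, ht', heq⟩
    · simp only [hYY] at ht
      obtain ⟨l₁, j, l₂, hsplit, hF, d, hd⟩ := inOrder_failures _
        (fun j _ => singleEvent_intChoiceOver_pre_skip (M.send i j)) t Y ht hn hY
      have hj : j ∈ M.outPeers i l := by simp [hsplit]
      have hC := (mem_outPeers.1 hj).2
      refine .send j hC d hd ((hsep.isOn_append hC p ?_).2 ((hp j hC).2 hj))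
      exact dataEvents_of_send (l := l) hF fun k hk => by simp [hsplit, hk]
    · have heq : t = s ++ t' := heq
      subst heq
      have hF := send_terminated hs
      have h1 := dataEvents_of_send hF fun _ => id
      have hn' : none ∉ t' := fun h => hn (by simp [h])
      have hp' : ∀ h, (i, h) ∈ M.C → (M.IsOn i h (p ++ s) ↔ h ∈ M.outPeers i l) :=
        fun h hC => (hsep.isOn_append hC p h1).trans (hp h hC)
      rcases ht' with ⟨-, ht⟩ | ⟨s', t'', hs', ht'', heq⟩
      · simp only [hYY] at ht
        obtain ⟨l₁, j, l₂, hsplit, hF', hd, hd'⟩ := inOrder_failures _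
          (fun j _ => singleEvent_receive i j) t' Y ht hn' hY
        have hj : j ∈ M.inPeers i l := by simp [hsplit]
        -- Without repetitions `j` was not yet served in this round; otherwise a receipt from `j`
        -- could follow the round's sends.
        have hjl : j ∉ l₁ := by
          have hnd : (M.inPeers i l).Nodup := hl.filter _
          rw [hsplit, List.nodup_append] at hnd
          exact fun h => hnd.2.2 j h j (by simp) rfl
        have hC := (mem_inPeers.1 hj).2
        have h2 : ∀ x ∈ t', x ∈ M.dataEvents i :=
          dataEvents_of_receive (l := l) hF' fun k hk => by simp [hsplit, hk]
        refine .receive j hC hd hd' fun h hCh hon => ?_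
        rw [← List.append_assoc, hsep.isOn_append hCh _ h2, hp' h hCh] at hon
        obtain ⟨e, hes, he⟩ := exists_mem_of_forall₂_right hF h hon
        -- The current round contains the send `e` to `h`, but no receipt from `j` and no turning on
        -- of `h`, so the past `p` is irrelevant.
        refine ⟨lastBefore_append p ?_ ⟨e, by simp [hes], he⟩,
          lastBefore_append p ?_ ⟨e, by simp [hes], he⟩⟩
        · intro x hx hxr
          rcases List.mem_append.1 hx with hx | hx
          · obtain ⟨k, hk, hxk⟩ := exists_mem_of_forall₂_left hF x hx
            exact Activity.noConfusion (hsep hC (mem_outPeers.1 hk).2 hxr hxk).1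
          · obtain ⟨k, hk, hxk⟩ := exists_mem_of_forall₂_left hF' x hx
            have hkl : k ∈ M.inPeers i l := by simp [hsplit, hk]
            have hCk := (mem_inPeers.1 hkl).2
            rcases hxk with hxk | hxk
            · exact hjl ((hsep hC hCk hxr hxk).2.1 ▸ hk)
            · exact Activity.noConfusion (hsep hC hCk hxr hxk).1
        · intro x hx hxr
          have hx : x ∈ M.dataEvents i := (List.mem_append.1 hx).elim (h1 x) (h2 x)
          rcases hx with ⟨k, hk, hxk⟩ | ⟨k, hk, hxk | hxk⟩ <;>
            exact Activity.noConfusion (hsep hCh hk hxr hxk).1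
      · have heq : t' = s' ++ t'' := heq
        subst heq
        have h2 := dataEvents_of_receive (receive_terminated hs') fun _ => id
        have := ih (p := p ++ s ++ s') (t := t'')
          (fun h hC => (hsep.isOn_append hC _ h2).trans (hp' h hC))
          (fun h => hn' (List.mem_append_right _ h)) ht''
        simpa using this

theorem sendReceive_nonTerminating (i : Fin n) (l : List (Fin n)) :
    (M.SendReceive i l).NonTerminating :=
  fun _ h => none_notMem_dataEvents i (sendReceive_traces h none (by simp))

theorem interruptible_terminated {i : Fin n} {l : List (Fin n)} {s : List (Obs E)}
    (h : s ++ [none] ∈ (interrupt (M.SendReceive i l) (intChoice SKIP STOP)).traces) :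
    s ∈ (M.SendReceive i l).traces := by
  rcases h with h | ⟨s', t, hs', hn, ⟨b, hb⟩, heq⟩
  · exact absurd h (sendReceive_nonTerminating i l s)
  · have ht : t = [] ∨ t = [none] := by
      cases b
      · exact Or.inl hb
      · exact hb
    rcases ht with rfl | rfl
    · exact absurd (by rw [← List.append_nil s', ← heq]; simp) hn
    · rwa [List.append_cancel_right heq]

/-- The interrupting process can only perform the tick. If the tick is refused and has not occurred,
only the clause in which `SendReceive` itself is stable survives. -/
theorem interruptible_failures {i : Fin n} {l : List (Fin n)} {t : List (Obs E)}
    {Y : Set (Obs E)} (hn : none ∉ t) (hY : none ∈ Y)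
    (h : (t, Y) ∈ (interrupt (M.SendReceive i l) (intChoice SKIP STOP)).failures) :
    (t, Y) ∈ (M.SendReceive i l).failures := by
  rcases h with (((⟨h, -, -⟩ | ⟨h, -⟩) | ⟨s, -, h⟩) | ⟨s, t', -, -, ⟨b, hb⟩, ht', h⟩) | ⟨-, -, -, h⟩
  · exact h
  · exact absurd h (sendReceive_nonTerminating i l t)
  · have h : t = s ++ [none] := h
    simp [h] at hn
  · have h : t = s ++ t' := h
    cases b
    · exact absurd hb ht'
    · rcases hb with hb | hb
      · exact absurd hb.1 ht'
      · have hb : t' = [none] := hb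
        simp [h, hb] at hn
  · exact absurd hY h

/-- Each cycle starts with all outgoing links off. `OnDetect` turns on exactly `outPeers`, the data
loop keeps this, and `OffDetect` restores the start. As no peer repeats, the entry at which
detection is stuck still has its old status. -/
theorem participantSpec_failures (hsep : M.Separated) {i : Fin n} {l : List (Fin n)}
    (hl : l.Nodup) {Y : Set (Obs E)} (hY : none ∈ Y) {t : List (Obs E)} (hn : none ∉ t)
    (h : (t, Y) ∈ (M.ParticipantSpec i l).failures) : M.Waiting i t Y := by
  obtain ⟨m, hm⟩ := h
  dsimp only at hm
  have hYY : Y ∪ {none} = Y := by simpa using hY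
  have hnd : (M.outPeers i l).Nodup := hl.filter _
  have notMem : ∀ {l₁ l₂ : List (Fin n)} {j : Fin n}, M.outPeers i l = l₁ ++ j :: l₂ →
      j ∉ l₁ := by
    intro l₁ l₂ j hsplit h
    rw [hsplit, List.nodup_append] at hnd
    exact hnd.2.2 j h j (by simp) rfl
  suffices H : ∀ p, (∀ h, (i, h) ∈ M.C → ¬ M.IsOn i h p) → M.Waiting i (p ++ t) Y from
    H [] fun h _ => not_lastBefore_nil _ _
  induction m generalizing t with
  | zero => exact absurd hm (Set.notMem_empty _)
  | succ m ih =>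
    intro p hp
    rw [Function.iterate_succ_apply'] at hm
    -- By separation, a block of one activity over `l'` meets the events of `(i, h)` only for that
    -- same activity and with `h` listed.
    have notIn : ∀ {k k' : Activity} {h : Fin n} {l' : List (Fin n)} {s : List (Obs E)},
        (i, h) ∈ M.C → (∀ j ∈ l', j ∈ M.outPeers i l) →
        List.Forall₂ (fun e j => e ∈ M.pairEvents k i j) s l' → (k = k' → h ∉ l') →
        ∀ x ∈ s, x ∉ M.pairEvents k' i h := by
      intro k k' h l' s hC hl' hF hne x hx hx'
      obtain ⟨j, hj, hxj⟩ := exists_mem_of_forall₂_left hF x hx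
      obtain ⟨h1, -, rfl⟩ := hsep (mem_outPeers.1 (hl' j hj)).2 hC hxj hx'
      exact hne h1 hj
    rcases hm with ⟨-, ht⟩ | ⟨s₁, t, hs₁, ht, heq⟩
    · simp only [hYY] at ht
      obtain ⟨l₁, j, l₂, hsplit, hF, hd⟩ := inOrder_failures (G := fun j =>
        M.pairEvents .turningOn i j) _ (fun j _ => singleEvent_pre_skip (M.turnOn i j)) t Y ht hn hY
      have hj : j ∈ M.outPeers i l := by simp [hsplit]
      have hC := (mem_outPeers.1 hj).2
      have hsub : ∀ k ∈ l₁, k ∈ M.outPeers i l := fun k hk => by simp [hsplit, hk]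
      refine .turnOn j hC hd fun h => hp j hC ((lastBefore_append_iff p ?_ ?_).1 h)
      · exact notIn hC hsub hF (by simp)
      · exact notIn hC hsub hF fun _ => notMem hsplit
    · obtain rfl := heq
      have hF₁ := inOrder_terminated (G := fun j => M.pairEvents .turningOn i j) _
        (fun j _ => singleEvent_pre_skip (M.turnOn i j)) s₁ hs₁
      have hp₁ : ∀ h, (i, h) ∈ M.C → (M.IsOn i h (p ++ s₁) ↔ h ∈ M.outPeers i l) := by
        intro h hC
        by_cases hh : h ∈ M.outPeers i l
        · exact iff_of_true (lastBefore_append p (notIn hC (fun _ => id) hF₁ (by simp))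
            (exists_mem_of_forall₂_right hF₁ h hh)) hh
        · refine iff_of_false (fun h' => hp h hC ((lastBefore_append_iff p ?_ ?_).1 h')) hh
          · exact notIn hC (fun _ => id) hF₁ (by simp)
          · exact notIn hC (fun _ => id) hF₁ fun _ => hh
      have hn₁ : none ∉ t := fun h => hn (by simp [h])
      rw [← List.append_assoc]
      rcases ht with ⟨-, ht⟩ | ⟨s₂, t, hs₂, ht, heq⟩
      · simp only [hYY] at ht
        exact sendReceive_failures hsep hl hY hp₁ hn₁ (interruptible_failures hn₁ hY ht)
      · obtain rfl := heq
        have h₂ := sendReceive_traces (interruptible_terminated hs₂)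
        have hp₂ : ∀ h, (i, h) ∈ M.C → (M.IsOn i h (p ++ s₁ ++ s₂) ↔ h ∈ M.outPeers i l) :=
          fun h hC => (hsep.isOn_append hC _ h₂).trans (hp₁ h hC)
        have hn₂ : none ∉ t := fun h => hn₁ (by simp [h])
        rw [← List.append_assoc]
        rcases ht with ⟨-, ht⟩ | ⟨s₃, t, hs₃, ht, heq⟩
        · simp only [hYY] at ht
          obtain ⟨l₁, j, l₂, hsplit, hF, hd⟩ := inOrder_failures (G := fun j =>
            M.pairEvents .turningOff i j) _ (fun j _ => singleEvent_pre_skip (M.turnOff i j))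
            t Y ht hn₂ hY
          have hj : j ∈ M.outPeers i l := by simp [hsplit]
          have hC := (mem_outPeers.1 hj).2
          have hsub : ∀ k ∈ l₁, k ∈ M.outPeers i l := fun k hk => by simp [hsplit, hk]
          refine .turnOff j hC hd ((lastBefore_append_iff _ ?_ ?_).2 ((hp₂ j hC).2 hj))
          · exact notIn hC hsub hF fun _ => notMem hsplit
          · exact notIn hC hsub hF (by simp)
        · obtain rfl := heq
          have hF₃ := inOrder_terminated (G := fun j => M.pairEvents .turningOff i j) _
            (fun j _ => singleEvent_pre_skip (M.turnOff i j)) s₃ hs₃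
          rw [← List.append_assoc]
          refine ih (fun h => hn₂ (by simp [h])) ht _ fun h hC => ?_
          by_cases hh : h ∈ M.outPeers i l
          · exact not_lastBefore_append _ (exists_mem_of_forall₂_right hF₃ h hh)
              (notIn hC (fun _ => id) hF₃ (by simp))
          · refine fun h' => hh ((hp₂ h hC).1 ((lastBefore_append_iff _ ?_ ?_).1 h'))
            · exact notIn hC (fun _ => id) hF₃ fun _ => hh
            · exact notIn hC (fun _ => id) hF₃ (by simp)

end AsyncDynamic

/-! ### Deadlocked states -/

namespace Network

open Sem

variable {E : Type u} {n : ℕ} {V : Network E n}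

open Classical in
/-- The part of the network trace `s` that consists of the vocabulary of component `c`. -/
noncomputable def vocTrace (V : Network E n) (c : Fin n) (s : List E) : List (Obs E) :=
  (s.map some).filter (fun x => decide (x ∈ some '' (V.A c ∩ V.Voc)))

theorem hideTrace_proj (c : Fin n) (s : List E) :
    hideTrace V.Vocᶜ (V.proj c s) = V.vocTrace c s := by
  simp only [hideTrace, proj, vocTrace, List.filter_map, List.filter_filter]
  congr 1
  apply List.filter_congr
  intro a _
  by_cases h1 : a ∈ V.A c <;> by_cases h2 : a ∈ V.Voc <;> simp [h1, h2]

theorem none_notMem_vocTrace (c : Fin n) (s : List E) : none ∉ V.vocTrace c s := by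
  simp [vocTrace]

/-- Deleting entries outside `α` and `β` does not change which set occurs last. This moves what each
component knows to the common network trace. -/
theorem lastBefore_vocTrace_iff {α β : Set (Obs E)} {c : Fin n} {s : List E}
    (ha : α ⊆ some '' (V.A c ∩ V.Voc)) (hb : β ⊆ some '' (V.A c ∩ V.Voc)) :
    LastBefore α β (V.vocTrace c s) ↔ LastBefore α β (s.map some) :=
  lastBefore_filter_iff _ (fun _ hx => by simpa using ha hx) fun _ hx => by simpa using hb hx

/-- In a deadlocked state of a live network every component abstractly refuses termination, and
every event shared by two components is refused by one of them. -/
theorem exists_abs_failures_of_deadlocked (hV : V.Live) {s : List E} {R : Fin n → Set (Obs E)}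
    (hs : V.IsState s R) (hD : V.Deadlocked R) :
    ∃ R' : Fin n → Set (Obs E), (∀ c, none ∈ R' c) ∧
      (∀ c, (V.vocTrace c s, R' c) ∈ (V.Abs c).failures) ∧
      ∀ c c' a, c ≠ c' → a ∈ V.A c → a ∈ V.A c' → some a ∈ R' c ∨ some a ∈ R' c' := by
  have refused : ∀ c, ∀ a ∈ V.A c, ∃ k, a ∈ V.A k ∧ some a ∈ R k := by
    intro c a ha
    have : a ∈ V.refusals R := by
      rw [hD]
      exact Set.mem_iUnion.2 ⟨c, ha⟩
    exact Set.mem_iUnion.1 this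
  -- Observations that `c` can never make, the tick included: by healthiness they can be added to
  -- any refusal.
  let N : Fin n → Set (Obs E) := fun c => {x | ∀ a ∈ V.A c, x ≠ some a}
  refine ⟨fun c => R c ∪ N c, fun c => Or.inr (by simp [N]), fun c => ?_, ?_⟩
  · refine ⟨V.proj c s, ?_, (hideTrace_proj c s).symm⟩
    -- Hiding requires the hidden events to be refused. A private event of `c` is refused by some
    -- component having it, which can only be `c`.
    have hsub : some '' V.Vocᶜ ⊆ R c ∪ N c := by
      rintro _ ⟨a, ha, rfl⟩
      by_cases hc : a ∈ V.A c
      · obtain ⟨k, hk, hR⟩ := refused c a hc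
        have : k = c := by
          by_contra hne
          exact ha ⟨k, c, hne, hk, hc⟩
        exact Or.inl (this ▸ hR)
      · refine Or.inr fun b hb hab => hc ?_
        rwa [Option.some.inj hab]
    have hU : R c ∪ N c ∪ some '' V.Vocᶜ = R c ∪ N c := Set.union_eq_left.2 hsub
    simp only [hU]
    refine (V.healthy c).refuse_impossible _ _ _ (hs c) fun x hx hmem => ?_
    cases x with
    | none => exact hV.nonTerminating c _ hmem
    | some a => exact hx a (V.events_mem c _ hmem a (by simp)) rfl
  · intro c c' a hne hc hc'
    obtain ⟨k, hk, hR⟩ := refused c a hc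
    by_cases h1 : k = c
    · exact Or.inl (Or.inl (h1 ▸ hR))
    by_cases h2 : k = c'
    · exact Or.inr (Or.inl (h2 ▸ hR))
    have : a ∈ V.A c ∩ V.A c' ∩ V.A k := ⟨⟨hc, hc'⟩, hk⟩
    rw [hV.tripleDisjoint c c' k hne (Ne.symm h2) (Ne.symm h1)] at this
    exact absurd this (Set.notMem_empty _)

end Network

/-! ### The descent argument -/

namespace AsyncDynamic

variable {E : Type u} {n : ℕ} {M : AsyncDynamic.{u, v} E n} {V : Network E n}

theorem StructurallyCompliant.pairEvents_subset_link (h : M.StructurallyCompliant V)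
    (k : Activity) {i j : Fin n} (hC : (i, j) ∈ M.C) :
    M.pairEvents k i j ⊆ some '' (V.A (M.link i j) ∩ V.Voc) := by
  intro x hx
  cases x with
  | none => exact absurd hx (M.none_notMem_pairEvents k i j)
  | some a => exact ⟨a, h.mem_link hC hx, rfl⟩

theorem StructurallyCompliant.pairEvents_subset_owner (h : M.StructurallyCompliant V)
    (k : Activity) {i j : Fin n} (hC : (i, j) ∈ M.C) :
    M.pairEvents k i j ⊆ some '' (V.A (owner k i j) ∩ V.Voc) := by
  intro x hx
  cases x with
  | none => exact absurd hx (M.none_notMem_pairEvents k i j)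
  | some a => exact ⟨a, h.mem_owner hC hx, rfl⟩

theorem StructurallyCompliant.participants_nonempty (h : M.StructurallyCompliant V)
    (hn : 0 < n) : M.participants.Nonempty := by
  have : (⟨0, hn⟩ : Fin n) ∈ M.participants ∪ M.transportEntities := by
    rw [h.partition_cover]
    trivial
  rcases this with h | ⟨i, j, hC, -⟩
  · exact ⟨_, h⟩
  · exact ⟨i, j, Or.inl hC⟩

/-- In a deadlocked state every participant `i` waits for data from some peer `f i` whose last
message to `i` has already been received.  As `f i` waits likewise, it last received from
`f (f i)` before it sent that message, so these times of last receipt decrease forever. -/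
theorem deadlockFree_of_compliant (hn : 0 < n) (hV : V.Live) {S : Fin n → List (Fin n)}
    (hstruct : M.StructurallyCompliant V) (hbehav : M.BehaviourallyCompliant V S) :
    V.DeadlockFree := by
  intro s R hs hD
  have hsep := hstruct.separated hV
  obtain ⟨Y, htick, hfail, hshared⟩ := Network.exists_abs_failures_of_deadlocked hV hs hD
  set T : List (Obs E) := s.map some with hT
  -- A pattern event cannot be offered by both its owner and its link.
  have blocked : ∀ {k : Activity} {i j : Fin n} {a : E}, (i, j) ∈ M.C →
      some a ∈ M.pairEvents k i j → some a ∉ Y (owner k i j) → some a ∉ Y (M.link i j) → False := by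
    intro k i j a hC ha h1 h2
    exact (hshared _ _ a (hstruct.owner_ne_link k hC hC) (hstruct.mem_owner hC ha).1
      (hstruct.mem_link hC ha).1).elim h1 h2
  have isOn_iff : ∀ {i j : Fin n}, (i, j) ∈ M.C →
      (M.IsOn i j (V.vocTrace i s) ↔ M.IsOn i j T) := fun {i j} hC =>
    Network.lastBefore_vocTrace_iff (hstruct.pairEvents_subset_owner .turningOff hC)
      (hstruct.pairEvents_subset_owner .turningOn hC)
  have link : ∀ i j, (i, j) ∈ M.C →
      ∃ st, M.TraceOf i j T st ∧ M.Offers i j (Y (M.link i j)) st := by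
    intro i j hC
    obtain ⟨st, h1, h2⟩ := transportSpec_failures hsep hC
      ((hbehav.transport i j hC).2 (hfail (M.link i j)))
    have sub := fun k => hstruct.pairEvents_subset_link k hC
    have hOn : M.IsOn i j (V.vocTrace (M.link i j) s) ↔ M.IsOn i j T :=
      Network.lastBefore_vocTrace_iff (sub _) (sub _)
    refine ⟨st, ?_, h2⟩
    cases st with
    | off => exact fun h => h1 (hOn.2 h)
    | onF d => exact hOn.1 h1
    | on => exact ⟨hOn.1 h1.1, h1.2.imp (Network.lastBefore_vocTrace_iff (sub _) (sub _)).1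
        (Network.lastBefore_vocTrace_iff (sub _) (sub _)).1⟩
  have active : ∀ {i j : Fin n}, (i, j) ∈ M.C → M.IsOn i j T →
      some (M.turnOff i j) ∉ Y (M.link i j) ∧ ∀ d, some (M.send i j d) ∉ Y (M.link i j) := by
    intro i j hC hon
    obtain ⟨st, h1, h2⟩ := link i j hC
    cases st with
    | off => exact absurd hon h1
    | onF d => exact ⟨h2.1, h2.2.1⟩
    | on => exact h2
  have waits : ∀ i ∈ M.participants, ∃ j, (j, i) ∈ M.C ∧ M.IsOn j i T ∧
      (LastBefore (M.pairEvents .sending j i) (M.pairEvents .receiving j i) T ∨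
        LastBefore (M.pairEvents .sending j i) (M.pairEvents .turningOn j i) T) ∧
      ∀ h, (i, h) ∈ M.C → M.IsOn i h T →
        LastBefore (M.pairEvents .receiving j i) (M.pairEvents .sending i h) T ∧
        LastBefore (M.pairEvents .turningOn i h) (M.pairEvents .sending i h) T := by
    intro i hi
    cases participantSpec_failures hsep (hbehav.no_repeats i hi) (htick i)
      (Network.none_notMem_vocTrace i s) ((hbehav.participant i hi).2 (hfail i)) with
    | turnOn j hC hY ht =>
      exfalso
      rw [isOn_iff hC] at ht
      obtain ⟨st, h1, h2⟩ := link i j hC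
      cases st with
      | off => exact blocked (k := .turningOn) hC rfl hY h2.1
      | onF d => exact ht h1
      | on => exact ht h1.1
    | turnOff j hC hY ht =>
      exact (blocked (k := .turningOff) hC rfl hY (active hC ((isOn_iff hC).1 ht)).1).elim
    | send j hC d hY ht =>
      exact (blocked (k := .sending) hC ⟨_, ⟨d, rfl⟩, rfl⟩ hY
        ((active hC ((isOn_iff hC).1 ht)).2 d)).elim
    | receive j hC hY hY' ht =>
      obtain ⟨st, h1, h2⟩ := link j i hC
      cases st with
      | off => exact (blocked (k := .timingOut) hC rfl hY' h2.2).elim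
      | onF d => exact (blocked (k := .receiving) hC ⟨_, ⟨d, rfl⟩, rfl⟩ (hY d) h2.2.2).elim
      -- An off link would offer the timeout and a full one the data, so only an empty active link
      -- can keep `i` waiting.
      | on =>
        refine ⟨j, hC, h1.1, h1.2, fun h hCh hon => ?_⟩
        refine (ht h hCh ((isOn_iff hCh).2 hon)).imp
          (Network.lastBefore_vocTrace_iff ?_ ?_).1 (Network.lastBefore_vocTrace_iff ?_ ?_).1
        · exact hstruct.pairEvents_subset_owner .receiving hC
        · exact hstruct.pairEvents_subset_owner .sending hCh
        · exact hstruct.pairEvents_subset_owner .turningOn hCh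
        · exact hstruct.pairEvents_subset_owner .sending hCh
  choose! f hfC hfOn hfLast hfSent using waits
  have hfp : ∀ i ∈ M.participants, f i ∈ M.participants := fun i hi => ⟨i, Or.inl (hfC i hi)⟩
  have descent : ∀ i ∈ M.participants,
      lastPos (M.pairEvents .receiving (f (f i)) (f i)) T <
        lastPos (M.pairEvents .receiving (f i) i) T := by
    intro i hi
    -- Since `f i` is itself waiting and `i` is one of its active peers, it sent to `i` after its
    -- last receipt and after turning that link on; `h2` excludes the alternative that the link was
    -- turned on after the last send.
    obtain ⟨h1, h2⟩ := hfSent (f i) (hfp i hi) i (hfC i hi) (hfOn i hi)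
    rcases hfLast i hi with h | h
    · exact lt_trans h1 h
    · exact absurd h (lt_asymm h2)
  have none_left : ∀ (m : ℕ), ∀ i ∈ M.participants,
      lastPos (M.pairEvents .receiving (f i) i) T ≠ m := by
    intro m
    induction m using Nat.strong_induction_on with
    | _ m ih =>
      rintro i hi rfl
      exact ih _ (descent i hi) (f i) (hfp i hi) rfl
  obtain ⟨i, hi⟩ := hstruct.participants_nonempty hn
  exact none_left _ i hi rfl

end AsyncDynamic

end CSP

theorem mainTheorem3 {E : Type*} {n : ℕ} (hn : 0 < n) (V : CSP.Network E n) (hV : V.Live)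
    (M : CSP.AsyncDynamic E n) (S : Fin n → List (Fin n))
    (hstruct : M.StructurallyCompliant V) (hbehav : M.BehaviourallyCompliant V S) :
    V.DeadlockFree :=
  CSP.AsyncDynamic.deadlockFree_of_compliant hn hV hstruct hbehav
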